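/- Let $A,B,C$ be real $n\times n$ matrices such that $A$, $B+I$ and $C$ are entrywise nonnegative, $A+B+I+C$ is irreducible, and $(A+B+I+C)e=e$, where $e=(1,\dots,1)^T$ (the data of a quasi-birth-death process, QBD). Let $p$ be the stationary probability vector of $A+B+I+C$, i.e. $p\ge 0$, $p^T(A+B+I+C)=p^T$, $p^Te=1$, and assume that the QBD is positive recurrent, i.e. $\rho=p^T(B+I+2A)e<1$. Put $\mathcal{Q}(X)=AX^2+BX+C$, whose Fréchet derivative at $X$ is the linear map $\mathcal{Q}'_X(Z)=AZX+AXZ+BZ$ on $\mathbb{R}^{n\times n}$. Matrix inequalities are entrywise. Let $S$ be the minimal nonnegative solution of $\mathcal{Q}(X)=0$, i.e. $S\ge0$, $\mathcal{Q}(S)=0$, and $S\le X$ for every $X\ge 0$ with $\mathcal{Q}(X)=0$. A nonsingular M-matrix is a real square matrix with nonpositive off-diagonal entries that can be written as $sI-N$ with $N\ge 0$ and $s$ larger than the spectral radius of $N$. Suppose that a matrix $X_0\in\mathbb{R}^{n\times n}$ satisfies (i) $\mathcal{Q}(X_0)\ge 0$, (ii) $0\le X_0\le S$, (iii) $-[(X_0^T\otimes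 A+I\otimes AX_0)+I\otimes B]$ is a nonsingular M-matrix. Let $(n_k)_{k\ge 0}$ be any sequence of integers $n_k\ge 0$. Define the Newton-Shamanskii iterates, for $k=0,1,2,\dots$, by $$X_{k,0}=X_k-(\mathcal{Q}'_{X_k})^{-1}\mathcal{Q}(X_k),\qquad X_{k,s}=X_{k,s-1}-(\mathcal{Q}'_{X_k})^{-1}\mathcal{Q}(X_{k,s-1})\quad (s=1,\dots,n_k),\qquad X_{k+1}=X_{k,n_k}.$$ Then the iterates are well defined, i.e. $\mathcal{Q}'_{X_k}$ is invertible for every $k\ge 0$; moreover $X_k\le X_{k+1}\le S$ for all $k\ge 0$, and $\lim_{k\to\infty}X_k=S$. -/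

import Mathlib

open scoped Kronecker

noncomputable section

namespace QBD

variable {m : ℕ}

/-- The entrywise order on real square matrices. -/
def EntryLE {ι : Type*} (X Y : Matrix ι ι ℝ) : Prop := ∀ i j, X i j ≤ Y i j

/-- The triple `A, B, C` is the data of a quasi-birth-death process: `A`, `B + I` and `C` are
entrywise nonnegative, `A + B + I + C` is irreducible, and `A + B + I + C` is (row) stochastic. -/
structure IsQBD (A B C : Matrix (Fin m) (Fin m) ℝ) : Prop where
  nonneg_A : EntryLE 0 A
  nonneg_B : EntryLE 0 (B + 1)
  nonneg_C : EntryLE 0 C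
  irreducible : (A + B + 1 + C).IsIrreducible
  stochastic : Matrix.mulVec (A + B + 1 + C) 1 = 1

/-- `p` is a stationary probability vector of the matrix `P`: `p ≥ 0`, `pᵀ P = pᵀ`, `pᵀ e = 1`. -/
structure IsStationary (P : Matrix (Fin m) (Fin m) ℝ) (p : Fin m → ℝ) : Prop where
  nonneg : ∀ i, 0 ≤ p i
  vecMul_eq : Matrix.vecMul p P = p
  sum_eq : p ⬝ᵥ 1 = 1

/-- The rate `ρ = pᵀ (B + I + 2 A) e`. -/
def rate (A B : Matrix (Fin m) (Fin m) ℝ) (p : Fin m → ℝ) : ℝ :=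
  p ⬝ᵥ Matrix.mulVec (B + 1 + (2 : ℝ) • A) 1

/-- The QBD process is positive recurrent: `ρ < 1`, where `ρ` is formed with the stationary
probability vector of `A + B + I + C` (unique, since that matrix is irreducible). -/
def IsPositiveRecurrent (A B C : Matrix (Fin m) (Fin m) ℝ) : Prop :=
  ∃ p : Fin m → ℝ, IsStationary (A + B + 1 + C) p ∧ rate A B p < 1

/-- The quadratic matrix function `Q(X) = A X² + B X + C`. -/
def Q (A B C X : Matrix (Fin m) (Fin m) ℝ) : Matrix (Fin m) (Fin m) ℝ :=
  A * X ^ 2 + B * X + C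

/-- `S` is the (entrywise) minimal nonnegative solution of `Q(X) = 0`. -/
structure IsMinimalNonnegSolution (A B C S : Matrix (Fin m) (Fin m) ℝ) : Prop where
  nonneg : EntryLE 0 S
  solution : Q A B C S = 0
  minimal : ∀ X, EntryLE 0 X → Q A B C X = 0 → EntryLE S X

/-- The Fréchet derivative of `Q` at `X`, the linear map `Z ↦ A Z X + A X Z + B Z`. -/
def QDeriv (A B X : Matrix (Fin m) (Fin m) ℝ) : Module.End ℝ (Matrix (Fin m) (Fin m) ℝ) where
  toFun Z := A * Z * X + A * X * Z + B * Z
  map_add' Z W := by noncomm_ring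
  map_smul' c Z := by simp [smul_add]

section

attribute [local instance] Matrix.linftyOpNormedRing Matrix.linftyOpNormedAlgebra

/-- `QDeriv A B X` is indeed the Fréchet derivative of `Q` at `X`. -/
theorem hasFDerivAt_Q (A B C X : Matrix (Fin m) (Fin m) ℝ) :
    HasFDerivAt (Q A B C) (LinearMap.toContinuousLinearMap (QDeriv A B X)) X := by
  have h := ((((hasFDerivAt_id (𝕜 := ℝ) X).mul' (hasFDerivAt_id (𝕜 := ℝ) X)).const_mul A).add
    ((hasFDerivAt_id (𝕜 := ℝ) X).const_mul B)).add_const C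
  have hf : Q A B C = fun Y => A * (Y * Y) + B * Y + C := by
    funext Y
    simp [Q, pow_two]
  rw [hf]
  refine HasFDerivAt.congr_fderiv h ?_
  refine ContinuousLinearMap.ext fun Z => ?_
  change A * (X * Z + Z * X) + B * Z = A * Z * X + A * X * Z + B * Z
  noncomm_ring

end

/-- A Z-matrix: all off-diagonal entries are nonpositive. -/
def IsZMatrix {ι : Type*} (M : Matrix ι ι ℝ) : Prop := ∀ i j, i ≠ j → M i j ≤ 0

/-- A nonsingular M-matrix: a Z-matrix of the form `s I - N` with `N ≥ 0` entrywise and `s > ρ(N)`,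
where `ρ(N)` is the spectral radius (the largest modulus of a complex eigenvalue). -/
def IsNonsingularMMatrix {ι : Type*} [Fintype ι] [DecidableEq ι] (M : Matrix ι ι ℝ) : Prop :=
  IsZMatrix M ∧ ∃ (s : ℝ) (N : Matrix ι ι ℝ), M = s • 1 - N ∧ EntryLE 0 N ∧
    spectralRadius ℂ (N.map (algebraMap ℝ ℂ)) < ENNReal.ofReal s

/-- The matrix `-[(Xᵀ ⊗ A + I ⊗ A X) + I ⊗ B]`, which represents `-Q'_X` on vectorized matrices. -/
def kroneckerMatrix (A B X : Matrix (Fin m) (Fin m) ℝ) :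
    Matrix (Fin m × Fin m) (Fin m × Fin m) ℝ :=
  -((X.transpose ⊗ₖ A + (1 : Matrix (Fin m) (Fin m) ℝ) ⊗ₖ (A * X)) +
    (1 : Matrix (Fin m) (Fin m) ℝ) ⊗ₖ B)

/-- `X - (Q'_N)⁻¹ Q(X)`. The operator `Ring.inverse` is the inverse when `Q'_N` is invertible, and
`0` by convention otherwise. -/
def frozenStep (A B C N X : Matrix (Fin m) (Fin m) ℝ) : Matrix (Fin m) (Fin m) ℝ :=
  X - Ring.inverse (QDeriv A B N) (Q A B C X)

/-- The inner iterates `X_{k,s}` with the derivative frozen at `Xk`: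
`X_{k,0} = Xk - (Q'_{Xk})⁻¹ Q(Xk)` and `X_{k,s} = X_{k,s-1} - (Q'_{Xk})⁻¹ Q(X_{k,s-1})`. -/
def innerIterate (A B C Xk : Matrix (Fin m) (Fin m) ℝ) : ℕ → Matrix (Fin m) (Fin m) ℝ
  | 0 => frozenStep A B C Xk Xk
  | s + 1 => frozenStep A B C Xk (innerIterate A B C Xk s)

/-- The Newton-Shamanskii iterates with inner step counts `n k`, started at `X₀`:
`X_{k+1} = X_{k, n_k}`. -/
def newtonShamanskii (A B C X₀ : Matrix (Fin m) (Fin m) ℝ) (n : ℕ → ℕ) :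
    ℕ → Matrix (Fin m) (Fin m) ℝ
  | 0 => X₀
  | k + 1 => innerIterate A B C (newtonShamanskii A B C X₀ n k) (n k)

end QBD

end

namespace QBD

variable {m : ℕ}

/-! Everything rests on inverse positivity of `-Q'_Y` for `0 ≤ Y ≤ S`. Since `Q'_Y + id` is a
positive operator, the minimum principle reduces this to finding `Z > 0` with `Q'_S Z < 0`; such a
`Z` then serves every such `Y`, because `Q'_Y Z ≤ Q'_S Z`.

To build `Z`, perturb `e` along a Poisson solution `w`: the drift `ρ - 1 < 0` gives `z > 1` and `v >
0` with `(z²A + zB + C)v < 0`. Minimality of `S` gives `Sv ≤ zv`. As `z²A + zB + C = (zA + AS +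
B)(zI - S)`, the vector `y = zv - Sv` is positive with `(zA + AS + B)y < 0`. A row `x > 0` with `xS
≤ zx` makes `Z = y xᵀ` work (`exists_QDeriv_neg`).

By inverse positivity, frozen Newton steps increase, stay below `S` and keep `Q ≥ 0`
(`frozenStep_spec`). Moreover `0 ≤ Q(X_k) ≤ X_{k+1} - X_k`, so the monotone limit solves `Q = 0` and
equals `S` by minimality. -/

/-- Minimum principle: if `z` is dominated below by its image `a` under a monotone map, and the map
sends a positive `z₀` to some `b < z₀`, then `z ≥ 0`. -/
theorem nonneg_of_subinvariant {κ : Type*} [Finite κ] {z z₀ a b : κ → ℝ}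
    (hmono : ∀ c : ℝ, (∀ k, c * z₀ k ≤ z k) → ∀ k, c * b k ≤ a k)
    (hz₀ : ∀ k, 0 < z₀ k) (hb : ∀ k, b k < z₀ k) (ha : ∀ k, a k ≤ z k) (k : κ) : 0 ≤ z k := by
  have : Nonempty κ := ⟨k⟩
  obtain ⟨k₀, hk₀⟩ := Finite.exists_min fun k => z k / z₀ k
  have hle : ∀ k, z k₀ / z₀ k₀ * z₀ k ≤ z k := fun k => by
    have := mul_le_mul_of_nonneg_right (hk₀ k) (hz₀ k).le
    rwa [div_mul_cancel₀ _ (hz₀ k).ne'] at this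
  have hc : 0 ≤ z k₀ / z₀ k₀ := by
    by_contra! hneg
    have h1 := (hmono _ hle k₀).trans (ha k₀)
    have h2 := mul_lt_mul_of_neg_left (hb k₀) hneg
    rw [div_mul_cancel₀ _ (hz₀ k₀).ne'] at h2
    exact absurd h1 (not_le.2 h2)
  exact (mul_nonneg hc (hz₀ k).le).trans (hle k)

/-! ### Entrywise order and monotone limits. -/

theorem entryLE_iff_sub {ι : Type*} {X Y : Matrix ι ι ℝ} : EntryLE X Y ↔ EntryLE 0 (Y - X) := by
  simp [EntryLE, Matrix.sub_apply, sub_nonneg]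

theorem EntryLE.trans {ι : Type*} {X Y Z : Matrix ι ι ℝ} (h : EntryLE X Y) (h' : EntryLE Y Z) :
    EntryLE X Z := fun i j => (h i j).trans (h' i j)

theorem EntryLE.antisymm {ι : Type*} {X Y : Matrix ι ι ℝ} (h : EntryLE X Y) (h' : EntryLE Y X) :
    X = Y := Matrix.ext fun i j => le_antisymm (h i j) (h' i j)

theorem EntryLE.add {ι : Type*} {X Y X' Y' : Matrix ι ι ℝ} (h : EntryLE X Y) (h' : EntryLE X' Y') :
    EntryLE (X + X') (Y + Y') := fun i j => add_le_add (h i j) (h' i j)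

theorem EntryLE.zero_add {ι : Type*} {X Y : Matrix ι ι ℝ} (h : EntryLE 0 X) (h' : EntryLE 0 Y) :
    EntryLE 0 (X + Y) := fun i j => add_nonneg (h i j) (h' i j)

theorem EntryLE.zero_mul {ι : Type*} [Fintype ι] {X Y : Matrix ι ι ℝ}
    (h : EntryLE 0 X) (h' : EntryLE 0 Y) : EntryLE 0 (X * Y) := fun i j => by
  rw [Matrix.mul_apply]
  exact Finset.sum_nonneg fun k _ => mul_nonneg (h i k) (h' k j)

theorem EntryLE.mul {ι : Type*} [Fintype ι] {X Y X' Y' : Matrix ι ι ℝ}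
    (hX : EntryLE 0 X) (h : EntryLE X Y) (hX' : EntryLE 0 X') (h' : EntryLE X' Y') :
    EntryLE (X * X') (Y * Y') := fun i j => by
  rw [Matrix.mul_apply, Matrix.mul_apply]
  exact Finset.sum_le_sum fun k _ =>
    mul_le_mul (h i k) (h' k j) (hX' k j) ((hX i k).trans (h i k))

theorem EntryLE.refl {ι : Type*} (X : Matrix ι ι ℝ) : EntryLE X X := fun _ _ => le_rfl

theorem EntryLE.mulVec_le {ι : Type*} [Fintype ι] {X : Matrix ι ι ℝ} {v w : ι → ℝ}
    (hX : EntryLE 0 X) (hvw : v ≤ w) : X.mulVec v ≤ X.mulVec w := fun i => by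
  simp only [Matrix.mulVec, dotProduct]
  exact Finset.sum_le_sum fun k _ => mul_le_mul_of_nonneg_left (hvw k) (hX i k)

theorem EntryLE.zero_pow {ι : Type*} [Fintype ι] [DecidableEq ι] {X : Matrix ι ι ℝ}
    (hX : EntryLE 0 X) (k : ℕ) : EntryLE 0 (X ^ k) := by
  induction k with
  | zero =>
    rw [pow_zero]
    intro i j
    rw [Matrix.one_apply]
    split_ifs <;> simp
  | succ k ih => rw [pow_succ]; exact ih.zero_mul hX

/-- An entrywise monotone and bounded sequence of matrices converges. -/
theorem exists_tendsto_of_monotone {ι : Type*} {X : ℕ → Matrix ι ι ℝ} {S : Matrix ι ι ℝ}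
    (hmono : ∀ k, EntryLE (X k) (X (k + 1))) (hS : ∀ k, EntryLE (X k) S) :
    ∃ L, Filter.Tendsto X Filter.atTop (nhds L) ∧ (∀ k, EntryLE (X k) L) ∧ EntryLE L S := by
  have hbdd : ∀ i j, BddAbove (Set.range fun k => X k i j) := fun i j =>
    ⟨S i j, by rintro _ ⟨k, rfl⟩; exact hS k i j⟩
  refine ⟨fun i j => ⨆ k, X k i j, ?_, fun k i j => le_ciSup (hbdd i j) k,
    fun i j => ciSup_le fun k => hS k i j⟩
  refine tendsto_pi_nhds.2 fun i => tendsto_pi_nhds.2 fun j => ?_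
  exact tendsto_atTop_ciSup (monotone_nat_of_le_succ fun k => hmono k i j) (hbdd i j)

theorem continuous_Q (A B C : Matrix (Fin m) (Fin m) ℝ) : Continuous (Q A B C) := by
  unfold Q
  fun_prop

/-! ### Stochastic matrices, the Poisson equation and the drift. -/

/-- Harmonic vectors of an irreducible stochastic matrix are constant. -/
theorem eq_of_mulVec_eq_self {ι : Type*} [Fintype ι] [DecidableEq ι] {P : Matrix ι ι ℝ}
    (hirr : P.IsIrreducible) (hP : P.mulVec 1 = 1) {w : ι → ℝ} (hw : P.mulVec w = w) (i j : ι) :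
    w i = w j := by
  have hpow : ∀ (u : ι → ℝ), P.mulVec u = u → ∀ k : ℕ, (P ^ k).mulVec u = u := by
    intro u hu k
    induction k with
    | zero => simp
    | succ k ih => rw [pow_succ, ← Matrix.mulVec_mulVec, hu, ih]
  have : Nonempty ι := ⟨i⟩
  obtain ⟨i₀, hi₀⟩ := Finite.exists_max w
  suffices h : ∀ j, w i₀ = w j from (h i).symm.trans (h j)
  intro j
  obtain ⟨k, -, hk⟩ := (Matrix.isIrreducible_iff_exists_pow_pos hirr.nonneg).1 hirr i₀ j
  -- The maximum `w i₀` is a `P ^ k`-weighted average of the `w l`, so it is attained wherever the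
  -- weight is positive.
  have hnn : ∀ l ∈ Finset.univ, 0 ≤ (P ^ k) i₀ l * (w i₀ - w l) := fun l _ =>
    mul_nonneg (EntryLE.zero_pow hirr.nonneg k i₀ l) (sub_nonneg.2 (hi₀ l))
  have hsum : ∑ l, (P ^ k) i₀ l * (w i₀ - w l) = 0 := by
    have h1 := congrFun (hpow 1 hP k) i₀
    have h2 := congrFun (hpow w hw k) i₀
    simp only [Matrix.mulVec, dotProduct, Pi.one_apply, mul_one] at h1 h2
    simp only [mul_sub, Finset.sum_sub_distrib, ← Finset.sum_mul, h1, h2]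
    ring
  have := (Finset.sum_eq_zero_iff_of_nonneg hnn).1 hsum j (Finset.mem_univ j)
  rcases mul_eq_zero.1 this with h | h
  · exact absurd h hk.ne'
  · linarith

/-- Solvability of the Poisson equation of an irreducible stochastic matrix. -/
theorem exists_poisson {P : Matrix (Fin m) (Fin m) ℝ} {p : Fin m → ℝ}
    (hirr : P.IsIrreducible) (hP : P.mulVec 1 = 1) (hp : IsStationary P p) (g : Fin m → ℝ) :
    ∃ w : Fin m → ℝ, ∀ i, P.mulVec w i - w i + g i = p ⬝ᵥ g := by
  -- The rank-one term `e pᵀ` removes the kernel of `P - I`, so `L` is bijective.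
  let L : (Fin m → ℝ) →ₗ[ℝ] (Fin m → ℝ) :=
    { toFun := fun w => P.mulVec w - w + (p ⬝ᵥ w) • (1 : Fin m → ℝ)
      map_add' := fun v w => by
        simp only [Matrix.mulVec_add, dotProduct_add, add_smul]; abel
      map_smul' := fun c w => by
        simp only [Matrix.mulVec_smul, dotProduct_smul, smul_eq_mul, RingHom.id_apply, smul_add,
          smul_sub, mul_smul] }
  have hpL : ∀ w, p ⬝ᵥ L w = p ⬝ᵥ w := fun w => by
    change p ⬝ᵥ (P.mulVec w - w + (p ⬝ᵥ w) • (1 : Fin m → ℝ)) = _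
    rw [dotProduct_add, dotProduct_sub, Matrix.dotProduct_mulVec, hp.vecMul_eq, dotProduct_smul,
      hp.sum_eq]
    simp
  have hinj : Function.Injective L := by
    rw [injective_iff_map_eq_zero]
    intro w hw
    have h0 : p ⬝ᵥ w = 0 := by rw [← hpL, hw, dotProduct_zero]
    have hw' : P.mulVec w = w := by
      have : P.mulVec w - w + (p ⬝ᵥ w) • (1 : Fin m → ℝ) = 0 := hw
      rwa [h0, zero_smul, add_zero, sub_eq_zero] at this
    funext i
    have hconst : w = w i • (1 : Fin m → ℝ) := funext fun j => by
      simp [eq_of_mulVec_eq_self hirr hP hw' j i]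
    rw [hconst, dotProduct_smul, hp.sum_eq] at h0
    simpa using h0
  obtain ⟨w, hw⟩ := LinearMap.injective_iff_surjective.1 hinj ((p ⬝ᵥ g) • (1 : Fin m → ℝ) - g)
  have h0 : p ⬝ᵥ w = 0 := by
    rw [← hpL, hw, dotProduct_sub, dotProduct_smul, hp.sum_eq]; simp
  refine ⟨w, fun i => ?_⟩
  have : P.mulVec w - w + (p ⬝ᵥ w) • (1 : Fin m → ℝ) = _ := hw
  rw [h0, zero_smul, add_zero] at this
  have := congrFun this i
  simp only [Pi.sub_apply, Pi.smul_apply, Pi.one_apply, smul_eq_mul, mul_one] at this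
  linarith

/-- Positive recurrence yields a strict geometric Lyapunov vector. -/
theorem exists_lyapunov {A B C : Matrix (Fin m) (Fin m) ℝ} (hQBD : IsQBD A B C)
    (hrec : IsPositiveRecurrent A B C) :
    ∃ (z : ℝ) (v : Fin m → ℝ), 1 < z ∧ (∀ i, 0 < v i) ∧
      ∀ i, z ^ 2 * A.mulVec v i + z * B.mulVec v i + C.mulVec v i < 0 := by
  obtain ⟨p, hp, hrate⟩ := hrec
  obtain ⟨w, hw⟩ := exists_poisson hQBD.irreducible hQBD.stochastic hp
    (A.mulVec 1 - C.mulVec 1)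
  set d := p ⬝ᵥ (A.mulVec 1 - C.mulVec 1) with hd
  -- `d = ρ - 1`, by subtracting `pᵀ(A + B + I + C)e = 1` from `ρ`.
  have hdneg : d < 0 := by
    have h1 : p ⬝ᵥ (A + B + 1 + C).mulVec 1 = 1 := by rw [hQBD.stochastic, hp.sum_eq]
    simp only [rate, Matrix.add_mulVec, Matrix.smul_mulVec, dotProduct_add, dotProduct_smul,
      smul_eq_mul] at hrate h1
    rw [hd, dotProduct_sub]
    linarith
  have hone : ∀ i, A.mulVec 1 i + B.mulVec 1 i + C.mulVec 1 i = 0 := fun i => by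
    have := congrFun hQBD.stochastic i
    simp only [Matrix.add_mulVec, Matrix.one_mulVec, Pi.add_apply, Pi.one_apply] at this
    linarith
  have hev : ∀ᶠ ε : ℝ in nhdsWithin 0 (Set.Ioi 0), ∀ i, 0 < 1 + ε * w i ∧
      d + ε * (A.mulVec 1 i + 2 * A.mulVec w i + B.mulVec w i) + ε ^ 2 * A.mulVec w i < 0 := by
    refine Filter.eventually_all.2 fun i => Filter.Eventually.and ?_ ?_
    · refine (Filter.Tendsto.eventually_const_lt (u := (0 : ℝ)) (v := 1) one_pos ?_)
      have : Continuous fun ε : ℝ => 1 + ε * w i := by fun_prop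
      simpa using (this.tendsto 0).mono_left nhdsWithin_le_nhds
    · refine (Filter.Tendsto.eventually_lt_const hdneg ?_)
      have : Continuous fun ε : ℝ =>
        d + ε * (A.mulVec 1 i + 2 * A.mulVec w i + B.mulVec w i) + ε ^ 2 * A.mulVec w i := by
        fun_prop
      simpa using (this.tendsto 0).mono_left nhdsWithin_le_nhds
  obtain ⟨ε, hε, hε0⟩ := (hev.and self_mem_nhdsWithin).exists
  have hε0 : 0 < ε := hε0
  -- The order-zero term in `ε` is `(A + B + C)e = 0`; the first-order coefficient is `d`.
  refine ⟨1 + ε, 1 + ε • w, by linarith, fun i => by simpa using (hε i).1, fun i => ?_⟩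
  have hwi := hw i
  simp only [Matrix.add_mulVec, Matrix.one_mulVec, Pi.add_apply, Pi.sub_apply] at hwi
  simp only [Matrix.mulVec_add, Matrix.mulVec_smul, Pi.add_apply, Pi.smul_apply, smul_eq_mul]
  have := mul_neg_of_pos_of_neg hε0 (hε i).2
  have key := hone i
  calc _ = ε * (d + ε * (A.mulVec 1 i + 2 * A.mulVec w i + B.mulVec w i)
        + ε ^ 2 * A.mulVec w i) := by
        linear_combination (1 + ε) * key + ε * hwi
    _ < 0 := this

/-! ### Vector bounds for the minimal solution. -/

/-- A supersolution vector of the QBD bounds the minimal solution. -/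
theorem IsMinimalNonnegSolution.mulVec_le {A B C S : Matrix (Fin m) (Fin m) ℝ}
    (hQBD : IsQBD A B C) (hS : IsMinimalNonnegSolution A B C S) {z : ℝ} {v : Fin m → ℝ}
    (hz : 0 ≤ z) (hv : 0 ≤ v)
    (h : ∀ i, z ^ 2 * A.mulVec v i + z * B.mulVec v i + C.mulVec v i ≤ 0) :
    S.mulVec v ≤ z • v := by
  -- Fixed-point form of `Q(X) = 0` with nonnegative coefficients; its iterates from `0` increase to
  -- `S`.
  let F : Matrix (Fin m) (Fin m) ℝ → Matrix (Fin m) (Fin m) ℝ :=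
    fun X => A * (X * X) + (B + 1) * X + C
  have hFQ : ∀ X, F X = Q A B C X + X := fun X => by simp only [F, Q]; noncomm_ring
  have hF0 : ∀ X, EntryLE 0 X → EntryLE 0 (F X) := fun X hX =>
    ((hQBD.nonneg_A.zero_mul (hX.zero_mul hX)).zero_add (hQBD.nonneg_B.zero_mul hX)).zero_add
      hQBD.nonneg_C
  have hFmono : ∀ X Y, EntryLE 0 X → EntryLE X Y → EntryLE (F X) (F Y) := fun X Y hX hXY =>
    ((EntryLE.mul hQBD.nonneg_A (.refl A) (hX.zero_mul hX) (.mul hX hXY hX hXY)).add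
      (.mul hQBD.nonneg_B (.refl _) hX hXY)).add (.refl C)
  let X : ℕ → Matrix (Fin m) (Fin m) ℝ := fun k => F^[k] 0
  have hXs : ∀ k, X (k + 1) = F (X k) := fun k => Function.iterate_succ_apply' F k 0
  have hX0 : ∀ k, EntryLE 0 (X k) := fun k => by
    induction k with
    | zero => exact .refl 0
    | succ k ih => rw [hXs]; exact hF0 _ ih
  have hXmono : ∀ k, EntryLE (X k) (X (k + 1)) := fun k => by
    induction k with
    | zero => exact hX0 1
    | succ k ih => rw [hXs, hXs (k + 1)]; exact hFmono _ _ (hX0 k) ih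
  have hXS : ∀ k, EntryLE (X k) S := fun k => by
    induction k with
    | zero => exact hS.nonneg
    | succ k ih =>
      have : F S = S := by rw [hFQ, hS.solution, zero_add]
      rw [hXs, ← this]; exact hFmono _ _ (hX0 k) ih
  have hXv : ∀ k, (X k).mulVec v ≤ z • v := fun k => by
    induction k with
    | zero =>
      have : (X 0).mulVec v = 0 := Matrix.zero_mulVec v
      rw [this]; exact smul_nonneg hz hv
    | succ k ih =>
      have h1 : (B + 1).mulVec ((X k).mulVec v) ≤ z • (B + 1).mulVec v := by
        rw [← Matrix.mulVec_smul]; exact hQBD.nonneg_B.mulVec_le ih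
      have h2 : (X k).mulVec ((X k).mulVec v) ≤ (z * z) • v := by
        refine ((hX0 k).mulVec_le ih).trans ?_
        rw [Matrix.mulVec_smul, mul_smul]
        exact smul_le_smul_of_nonneg_left ih hz
      have h3 : A.mulVec ((X k).mulVec ((X k).mulVec v)) ≤ (z * z) • A.mulVec v := by
        rw [← Matrix.mulVec_smul]; exact hQBD.nonneg_A.mulVec_le h2
      intro i
      have h1 := h1 i
      have h3 := h3 i
      have h4 := h i
      rw [hXs]
      simp only [F, Matrix.add_mulVec, Matrix.one_mulVec, ← Matrix.mulVec_mulVec, Pi.add_apply,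
        Pi.smul_apply, smul_eq_mul] at h1 h3 h4 ⊢
      linarith
  obtain ⟨L, hL, hXL, hLS⟩ := exists_tendsto_of_monotone hXmono hXS
  have hFL : F L = L := by
    have hc : Continuous F := by fun_prop
    refine tendsto_nhds_unique ((hc.tendsto L).comp hL) ?_
    have : (F ∘ X) = fun k => X (k + 1) := funext fun k => (hXs k).symm
    rw [this]
    exact hL.comp (Filter.tendsto_add_atTop_nat 1)
  have hSL : S = L := EntryLE.antisymm
    (hS.minimal L (hXL 0) (by have := hFQ L; rw [hFL] at this; simpa using this)) hLS
  have hc : Continuous fun Y : Matrix (Fin m) (Fin m) ℝ => Y.mulVec v := by fun_prop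
  rw [hSL]
  exact le_of_tendsto ((hc.tendsto L).comp hL) (Filter.Eventually.of_forall hXv)

/-- A nonnegative matrix with a strictly subinvariant positive column vector has a subinvariant
positive row vector. -/
theorem exists_vecMul_le {N : Matrix (Fin m) (Fin m) ℝ} {v : Fin m → ℝ} (hN : EntryLE 0 N)
    (hv : ∀ i, 0 < v i) (hNv : ∀ i, N.mulVec v i < v i) :
    ∃ x : Fin m → ℝ, (∀ i, 0 < x i) ∧ ∀ i, Matrix.vecMul x N i ≤ x i := by
  have hpos : ∀ u : Fin m → ℝ, 0 ≤ (1 - N).mulVec u → 0 ≤ u := fun u hu => by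
    refine nonneg_of_subinvariant (a := N.mulVec u) (b := N.mulVec v) (fun c hc k => ?_) hv hNv
      fun k => ?_
    · have := hN.mulVec_le (v := c • v) (w := u) hc k
      simpa [Matrix.mulVec_smul] using this
    · have := hu k
      simpa [Matrix.sub_mulVec] using this
  have hunit : IsUnit (1 - N) := by
    rw [← Matrix.mulVec_injective_iff_isUnit]
    intro u u' huu
    have h : (1 - N).mulVec (u - u') = 0 := by
      rw [Matrix.mulVec_sub]; exact sub_eq_zero.2 huu
    have h1 := hpos _ h.ge
    have h2 := hpos (u' - u) (by rw [← neg_sub u u', Matrix.mulVec_neg, h, neg_zero])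
    exact le_antisymm (sub_nonneg.1 h2) (sub_nonneg.1 h1)
  have hdet := (Matrix.isUnit_iff_isUnit_det _).1 hunit
  have hinv : EntryLE 0 (1 - N)⁻¹ := fun i j => by
    have h := hpos ((1 - N)⁻¹.mulVec (Pi.single j 1)) (by
      rw [Matrix.mulVec_mulVec, Matrix.mul_nonsing_inv _ hdet, Matrix.one_mulVec]
      exact Pi.single_nonneg.2 zero_le_one) i
    simpa using h
  -- This row satisfies `x = xN + eᵀ`.
  refine ⟨Matrix.vecMul 1 (1 - N)⁻¹, ?_⟩
  set x := Matrix.vecMul 1 (1 - N)⁻¹ with hx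
  have hx0 : ∀ i, 0 ≤ x i := fun i => by
    simp only [hx, Matrix.vecMul, dotProduct]
    exact Finset.sum_nonneg fun k _ => mul_nonneg zero_le_one (hinv k i)
  have hxN : ∀ i, x i = Matrix.vecMul x N i + 1 := fun i => by
    have h : Matrix.vecMul x (1 - N) = 1 := by
      rw [hx, Matrix.vecMul_vecMul, Matrix.nonsing_inv_mul _ hdet, Matrix.vecMul_one]
    have := congrFun h i
    simp only [Matrix.vecMul_sub, Matrix.vecMul_one, Pi.sub_apply, Pi.one_apply] at this
    linarith
  have hxN0 : ∀ i, 0 ≤ Matrix.vecMul x N i := fun i => by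
    simp only [Matrix.vecMul, dotProduct]
    exact Finset.sum_nonneg fun k _ => mul_nonneg (hx0 k) (hN k i)
  exact ⟨fun i => by linarith [hxN i, hxN0 i], fun i => by linarith [hxN i]⟩

/-! ### The derivative and its inverse positivity. -/

theorem QDeriv_apply (A B X Z : Matrix (Fin m) (Fin m) ℝ) :
    QDeriv A B X Z = A * Z * X + A * X * Z + B * Z := rfl

theorem Q_add (A B C X H : Matrix (Fin m) (Fin m) ℝ) :
    Q A B C (X + H) = Q A B C X + QDeriv A B X H + A * (H * H) := by
  simp only [Q, QDeriv_apply]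
  noncomm_ring

theorem QDeriv_add_self_nonneg {A B Y Z : Matrix (Fin m) (Fin m) ℝ} (hA : EntryLE 0 A)
    (hB : EntryLE 0 (B + 1)) (hY : EntryLE 0 Y) (hZ : EntryLE 0 Z) :
    EntryLE 0 (QDeriv A B Y Z + Z) := by
  have : QDeriv A B Y Z + Z = A * Z * Y + A * Y * Z + (B + 1) * Z := by
    rw [QDeriv_apply]; noncomm_ring
  rw [this]
  exact (((hA.zero_mul hZ).zero_mul hY).zero_add ((hA.zero_mul hY).zero_mul hZ)).zero_add
    (hB.zero_mul hZ)

theorem QDeriv_mono {A B X Y Z : Matrix (Fin m) (Fin m) ℝ} (hA : EntryLE 0 A)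
    (hXY : EntryLE X Y) (hZ : EntryLE 0 Z) : EntryLE (QDeriv A B X Z) (QDeriv A B Y Z) := by
  rw [entryLE_iff_sub] at hXY ⊢
  have : QDeriv A B Y Z - QDeriv A B X Z = A * Z * (Y - X) + A * (Y - X) * Z := by
    simp only [QDeriv_apply]; noncomm_ring
  rw [this]
  exact ((hA.zero_mul hZ).zero_mul hXY).zero_add ((hA.zero_mul hXY).zero_mul hZ)

/-- Positive recurrence makes `-Q'_S` strictly positive on some positive matrix. -/
theorem exists_QDeriv_neg {A B C S : Matrix (Fin m) (Fin m) ℝ} (hQBD : IsQBD A B C)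
    (hrec : IsPositiveRecurrent A B C) (hS : IsMinimalNonnegSolution A B C S) :
    ∃ Z : Matrix (Fin m) (Fin m) ℝ, (∀ i j, 0 < Z i j) ∧ ∀ i j, QDeriv A B S Z i j < 0 := by
  obtain ⟨z, v, hz, hv, hlyap⟩ := exists_lyapunov hQBD hrec
  have hz0 : 0 < z := one_pos.trans hz
  have hSv := hS.mulVec_le hQBD hz0.le (fun i => (hv i).le) fun i => (hlyap i).le
  set y : Fin m → ℝ := z • v - S.mulVec v with hy
  have hy0 : 0 ≤ y := sub_nonneg.2 hSv
  have hAy0 : ∀ i, 0 ≤ A.mulVec y i := fun i => by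
    simpa using hQBD.nonneg_A.mulVec_le hy0 i
  have hASy0 : ∀ i, 0 ≤ (A * S).mulVec y i := fun i => by
    simpa using (hQBD.nonneg_A.zero_mul hS.nonneg).mulVec_le hy0 i
  have hBy0 : ∀ i, 0 ≤ B.mulVec y i + y i := fun i => by
    simpa [Matrix.add_mulVec] using hQBD.nonneg_B.mulVec_le hy0 i
  have hyneg : ∀ i, z * A.mulVec y i + (A * S).mulVec y i + B.mulVec y i < 0 := fun i => by
    have hsol := congrFun (congrArg (fun M => M.mulVec v) hS.solution) i
    simp only [Q, pow_two, Matrix.add_mulVec, ← Matrix.mulVec_mulVec, Pi.add_apply,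
      Matrix.zero_mulVec, Pi.zero_apply] at hsol
    have := hlyap i
    simp only [hy, Matrix.mulVec_sub, Matrix.mulVec_smul, ← Matrix.mulVec_mulVec, Pi.sub_apply,
      Pi.smul_apply, smul_eq_mul]
    linarith
  -- Rewriting `B = (B + I) - I` in `hyneg` leaves `-y` as the only possibly negative term.
  have hypos : ∀ i, 0 < y i := fun i => by
    linarith [hyneg i, hBy0 i, hASy0 i, mul_nonneg hz0.le (hAy0 i)]
  obtain ⟨x, hx, hxS⟩ := exists_vecMul_le (N := z⁻¹ • S) (v := v)
    (fun i j => mul_nonneg (inv_nonneg.2 hz0.le) (hS.nonneg i j)) hv fun i => by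
      have := hypos i
      simp only [hy, Pi.sub_apply, Pi.smul_apply, smul_eq_mul, sub_pos] at this
      rw [Matrix.smul_mulVec, Pi.smul_apply, smul_eq_mul, inv_mul_lt_iff₀ hz0]
      exact this
  have hxS' : ∀ j, Matrix.vecMul x S j ≤ z * x j := fun j => by
    have := hxS j
    rwa [Matrix.vecMul_smul, Pi.smul_apply, smul_eq_mul, inv_mul_le_iff₀ hz0] at this
  refine ⟨Matrix.vecMulVec y x, fun i j => mul_pos (hypos i) (hx j), fun i j => ?_⟩
  have : QDeriv A B S (Matrix.vecMulVec y x) i j =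
      A.mulVec y i * Matrix.vecMul x S j + (A * S).mulVec y i * x j + B.mulVec y i * x j := by
    simp only [QDeriv_apply, Matrix.mul_vecMulVec, Matrix.vecMulVec_mul, Matrix.add_apply,
      Matrix.vecMulVec_apply]
  rw [this]
  calc _ ≤ A.mulVec y i * (z * x j) + (A * S).mulVec y i * x j + B.mulVec y i * x j := by
        gcongr
        · exact hAy0 i
        · exact hxS' j
    _ = (z * A.mulVec y i + (A * S).mulVec y i + B.mulVec y i) * x j := by ring
    _ < 0 := mul_neg_of_neg_of_pos (hyneg i) (hx j)

/-- `-Q'_Y` is inverse-positive for `0 ≤ Y ≤ S`. -/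
theorem nonneg_of_QDeriv_nonpos {A B C S Y H : Matrix (Fin m) (Fin m) ℝ} (hQBD : IsQBD A B C)
    (hrec : IsPositiveRecurrent A B C) (hS : IsMinimalNonnegSolution A B C S)
    (hY : EntryLE 0 Y) (hYS : EntryLE Y S) (hH : EntryLE (QDeriv A B Y H) 0) : EntryLE 0 H := by
  obtain ⟨Z, hZ, hZneg⟩ := exists_QDeriv_neg hQBD hrec hS
  have hZY := QDeriv_mono (B := B) hQBD.nonneg_A hYS fun i j => (hZ i j).le
  have key := nonneg_of_subinvariant (κ := Fin m × Fin m) (z := fun k => H k.1 k.2)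
    (z₀ := fun k => Z k.1 k.2) (a := fun k => QDeriv A B Y H k.1 k.2 + H k.1 k.2)
    (b := fun k => QDeriv A B Y Z k.1 k.2 + Z k.1 k.2) (fun c hc k => ?_) (fun k => hZ k.1 k.2)
    (fun k => by linarith [hZY k.1 k.2, hZneg k.1 k.2])
    (fun k => by
      have : QDeriv A B Y H k.1 k.2 ≤ 0 := hH k.1 k.2
      linarith)
  · exact fun i j => key (i, j)
  -- Positivity of `Q'_Y + id`, applied to `H - cZ ≥ 0`.
  · have := QDeriv_add_self_nonneg hQBD.nonneg_A hQBD.nonneg_B hY (Z := H - c • Z)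
      (fun i j => by simpa using hc (i, j)) k.1 k.2
    simp only [map_sub, map_smul, Matrix.add_apply, Matrix.sub_apply, Matrix.smul_apply,
      smul_eq_mul, Matrix.zero_apply] at this
    linarith

theorem isUnit_QDeriv {A B C S Y : Matrix (Fin m) (Fin m) ℝ} (hQBD : IsQBD A B C)
    (hrec : IsPositiveRecurrent A B C) (hS : IsMinimalNonnegSolution A B C S)
    (hY : EntryLE 0 Y) (hYS : EntryLE Y S) : IsUnit (QDeriv A B Y) := by
  rw [LinearMap.isUnit_iff_ker_eq_bot, LinearMap.ker_eq_bot']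
  intro H hH
  have h1 := nonneg_of_QDeriv_nonpos hQBD hrec hS hY hYS (H := H) (by rw [hH]; exact .refl 0)
  have h2 := nonneg_of_QDeriv_nonpos hQBD hrec hS hY hYS (H := -H)
    (by rw [map_neg, hH, neg_zero]; exact .refl 0)
  refine EntryLE.antisymm (entryLE_iff_sub.2 ?_) h1
  rwa [zero_sub]

/-! ### Monotonicity of the iteration. -/

/-- One Newton step with frozen derivative preserves the monotone bracketing of `S`. -/
theorem frozenStep_spec {A B C S N X : Matrix (Fin m) (Fin m) ℝ} (hQBD : IsQBD A B C)
    (hrec : IsPositiveRecurrent A B C) (hS : IsMinimalNonnegSolution A B C S)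
    (hN : EntryLE 0 N) (hNX : EntryLE N X) (hXS : EntryLE X S) (hQ : EntryLE 0 (Q A B C X)) :
    EntryLE X (frozenStep A B C N X) ∧ EntryLE (frozenStep A B C N X) S ∧
      EntryLE 0 (Q A B C (frozenStep A B C N X)) ∧
      EntryLE (Q A B C X) (frozenStep A B C N X - X) := by
  have hNS := hNX.trans hXS
  obtain ⟨H, hHY, hNH⟩ : ∃ H, frozenStep A B C N X = X + H ∧ QDeriv A B N H = -Q A B C X := by
    refine ⟨-Ring.inverse (QDeriv A B N) (Q A B C X), sub_eq_add_neg _ _, ?_⟩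
    rw [map_neg, ← Module.End.mul_apply,
      Ring.mul_inverse_cancel _ (isUnit_QDeriv hQBD hrec hS hN hNS), Module.End.one_apply]
  have hH : EntryLE 0 H := nonneg_of_QDeriv_nonpos hQBD hrec hS hN hNS
    (by rw [hNH]; exact fun i j => neg_nonpos.2 (hQ i j))
  rw [hHY]
  refine ⟨fun i j => le_add_of_nonneg_right (hH i j), ?_, ?_, ?_⟩
  -- `Q'_N(S - X - H) ≤ Q'_X(S - X) + Q(X) = -A(S - X)² ≤ 0`.
  · rw [entryLE_iff_sub]
    refine nonneg_of_QDeriv_nonpos hQBD hrec hS hN hNS ?_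
    have hD := entryLE_iff_sub.1 hXS
    have hQS := Q_add A B C X (S - X)
    rw [add_sub_cancel, hS.solution] at hQS
    have hmono := QDeriv_mono (B := B) hQBD.nonneg_A hNX hD
    have hsq := hQBD.nonneg_A.zero_mul (hD.zero_mul hD)
    intro i j
    have e := congrFun (congrFun hQS i) j
    rw [← sub_sub, map_sub, hNH]
    have := hmono i j
    have := hsq i j
    simp only [Matrix.add_apply, Matrix.sub_apply, Matrix.neg_apply, Matrix.zero_apply] at *
    linarith
  -- `Q'_X H ≥ Q'_N H = -Q(X)` leaves `Q(X + H) ≥ AH²`.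
  · rw [Q_add]
    have hmono := QDeriv_mono (B := B) hQBD.nonneg_A hNX hH
    rw [hNH] at hmono
    refine EntryLE.zero_add (fun i j => ?_) (hQBD.nonneg_A.zero_mul (hH.zero_mul hH))
    have := hmono i j
    simp only [Matrix.add_apply, Matrix.neg_apply, Matrix.zero_apply] at *
    linarith
  -- `Q'_N H + H ≥ 0` reads `H ≥ Q(X)`; this is what forces the limit to be a solution.
  · have := QDeriv_add_self_nonneg hQBD.nonneg_A hQBD.nonneg_B hN hH
    rw [hNH] at this
    rw [add_sub_cancel_left, entryLE_iff_sub, sub_eq_neg_add]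
    exact this

theorem innerIterate_spec {A B C S X : Matrix (Fin m) (Fin m) ℝ} (hQBD : IsQBD A B C)
    (hrec : IsPositiveRecurrent A B C) (hS : IsMinimalNonnegSolution A B C S)
    (hX : EntryLE 0 X) (hXS : EntryLE X S) (hQ : EntryLE 0 (Q A B C X)) (s : ℕ) :
    EntryLE X (innerIterate A B C X s) ∧ EntryLE (innerIterate A B C X s) S ∧
      EntryLE 0 (Q A B C (innerIterate A B C X s)) ∧
      EntryLE (Q A B C X) (innerIterate A B C X s - X) := by
  induction s with
  | zero => exact frozenStep_spec hQBD hrec hS hX (.refl X) hXS hQ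
  | succ s ih =>
    obtain ⟨h1, h2, h3, h4⟩ := ih
    obtain ⟨g1, g2, g3, -⟩ := frozenStep_spec hQBD hrec hS hX h1 h2 h3
    exact ⟨h1.trans g1, g2, g3, h4.trans fun i j => sub_le_sub_right (g1 i j) (X i j)⟩

theorem newtonShamanskii_spec {A B C S X₀ : Matrix (Fin m) (Fin m) ℝ} (hQBD : IsQBD A B C)
    (hrec : IsPositiveRecurrent A B C) (hS : IsMinimalNonnegSolution A B C S)
    (hQ : EntryLE 0 (Q A B C X₀)) (h0 : EntryLE 0 X₀) (h0S : EntryLE X₀ S) (n : ℕ → ℕ) (k : ℕ) :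
    EntryLE 0 (newtonShamanskii A B C X₀ n k) ∧ EntryLE (newtonShamanskii A B C X₀ n k) S ∧
      EntryLE 0 (Q A B C (newtonShamanskii A B C X₀ n k)) := by
  induction k with
  | zero => exact ⟨h0, h0S, hQ⟩
  | succ k ih =>
    obtain ⟨h1, h2, h3⟩ := ih
    obtain ⟨g1, g2, g3, -⟩ := innerIterate_spec hQBD hrec hS h1 h2 h3 (n k)
    exact ⟨h1.trans g1, g2, g3⟩

end QBD

theorem mainTheorem1 {m : ℕ} (A B C S X₀ : Matrix (Fin m) (Fin m) ℝ)
    (hQBD : QBD.IsQBD A B C)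
    (hrec : QBD.IsPositiveRecurrent A B C)
    (hS : QBD.IsMinimalNonnegSolution A B C S)
    (hQ : QBD.EntryLE 0 (QBD.Q A B C X₀))
    (h0 : QBD.EntryLE 0 X₀) (h0S : QBD.EntryLE X₀ S)
    (hM : QBD.IsNonsingularMMatrix (QBD.kroneckerMatrix A B X₀))
    (n : ℕ → ℕ) :
    -- the iterates are well defined: every derivative that is inverted is invertible
    (∀ k, IsUnit (QBD.QDeriv A B (QBD.newtonShamanskii A B C X₀ n k))) ∧
    -- monotonicity and boundedness
    (∀ k, QBD.EntryLE (QBD.newtonShamanskii A B C X₀ n k)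
        (QBD.newtonShamanskii A B C X₀ n (k + 1)) ∧
      QBD.EntryLE (QBD.newtonShamanskii A B C X₀ n (k + 1)) S) ∧
    -- convergence
    Filter.Tendsto (QBD.newtonShamanskii A B C X₀ n) Filter.atTop (nhds S) := by
  have hX := QBD.newtonShamanskii_spec hQBD hrec hS hQ h0 h0S n
  have hstep := fun k => QBD.innerIterate_spec hQBD hrec hS (hX k).1 (hX k).2.1 (hX k).2.2 (n k)
  refine ⟨fun k => QBD.isUnit_QDeriv hQBD hrec hS (hX k).1 (hX k).2.1,
    fun k => ⟨(hstep k).1, (hX (k + 1)).2.1⟩, ?_⟩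
  obtain ⟨L, hL, hXL, hLS⟩ := QBD.exists_tendsto_of_monotone
    (X := QBD.newtonShamanskii A B C X₀ n) (fun k => (hstep k).1) fun k => (hX k).2.1
  have hQlim := ((QBD.continuous_Q A B C).tendsto L).comp hL
  have hdiff := (hL.comp (Filter.tendsto_add_atTop_nat 1)).sub hL
  rw [sub_self] at hdiff
  have hQL : QBD.Q A B C L = 0 := by
    ext i j
    have hent : Continuous fun M : Matrix (Fin m) (Fin m) ℝ => M i j := by fun_prop
    exact le_antisymm
      -- `Q(X_k)` is squeezed between `0` and the vanishing increments.
      (le_of_tendsto_of_tendsto' ((hent.tendsto _).comp hQlim) ((hent.tendsto _).comp hdiff)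
        fun k => (hstep k).2.2.2 i j)
      (ge_of_tendsto' ((hent.tendsto _).comp hQlim) fun k => (hX k).2.2 i j)
  have hSL : S = L := QBD.EntryLE.antisymm
    (hS.minimal L ((hX 0).1.trans (hXL 0)) hQL) hLS
  rwa [← hSL] at hL
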